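/- Let $E$ be a Radon topological space, i.e. a space homeomorphic to a universally measurable subset of a compact metric space. For a topological space $S$ let $\mathcal B^u(S)$ be the $\sigma$-algebra of universally measurable subsets of $S$ (the intersection of the completions of the Borel $\sigma$-algebra with respect to all finite Borel measures), and write $\mathcal E^u=\mathcal B^u(E)$. A (Markov) transition function on $(S,\mathcal B^u(S))$ is a family $(Q_t)_{t\ge 0}$ of Markov kernels on $(S,\mathcal B^u(S))$ with $Q_{t+s}(x,B)=\int_S Q_t(x,dy)\,Q_s(y,B)$ for all $s,t\ge 0$, $x\in S$, $B\in\mathcal B^u(S)$; it is normal if $Q_0(x,B)=1_B(x)$. It satisfies (HD1) if for every probability law $\mu$ on $S$ there are a filtered probability space $(\Omega,\mathcal G,(\mathcal G_t)_{t\ge 0},\mathbf P)$ and an $S$-valued process $(X_t)_{t\ge 0}$, all of whose paths are right continuous, such that each $X_t$ is $\mathcal G_t/\mathcal B^u(S)$-measurable, $X_0$ has law $\mu$, and $\mathbf P\{f(X_{t+s})\mid\mathcal G_t\}=Q_sf(X_t)$ almost surely for all $s,t\ge 0$ and all bounded $\mathcal B^u(S)$-measurable $f:S\to\mathbb R$.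 The resolvent of such a $(Q_t)$ is $V^\alpha f(x)=\int_0^\infty e^{-\alpha t}Q_tf(x)\,dt$, for $\alpha>0$ and $\mathcal B^u(S)$-measurable $f:S\to[0,\infty]$. Let $(P_t)_{t\ge 0}$ be a normal Markov transition function on $(E,\mathcal E^u)$ satisfying (HD1), with resolvent $(U^\alpha)_{\alpha>0}$, and let $X$ be its canonical realization: $\Omega$ is the set of right continuous maps $\omega:[0,\infty)\to E$, $X_t(\omega)=\omega(t)$, $\mathcal F^u=\sigma(X_s^{-1}(B): s\ge 0, B\in\mathcal E^u)$, $\mathcal F^u_t=\sigma(X_s^{-1}(B): 0\le s\le t, B\in\mathcal E^u)$, and $\mathbf P^x$, $x\in E$, is the probability measure on $(\Omega,\mathcal F^u)$ under which $X_0=x$ almost surely and $(X_t)$ satisfies the above Markov property with transition function $(P_t)$ relative to $(\mathcal F^u_t)$. For a probability law $\mu$ on $E$ put $\mathbf P^\mu=\int_E\mu(dx)\,\mathbf P^x$. Let $N\in\mathcal E^u$ be weakly $U$-negligible, i.e. $U^\alpha 1_N(x)=0$ for all $x\in E\setminus N$, for one (equivalently, all) $\alpha>0$. Equip $\tilde E=E\setminus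 N$ with the subspace topology, write $\tilde{\mathcal E}^u=\mathcal B^u(\tilde E)$, and let $\tilde U^\alpha\tilde f=(U^\alpha f)|_{\tilde E}$ for $\alpha>0$ and $\tilde{\mathcal E}^u$-measurable $\tilde f:\tilde E\to[0,\infty]$, where $f$ is any $\mathcal E^u$-measurable extension of $\tilde f$ to $E$ with values in $[0,\infty]$. Then the following are equivalent: (a) there is a Markov transition function $(\tilde P_t)_{t\ge 0}$ on $(\tilde E,\tilde{\mathcal E}^u)$ satisfying (HD1) whose resolvent is $(\tilde U^\alpha)_{\alpha>0}$; (b) $\tilde E$ is quasi-absorbing for $X$, i.e. for every probability law $\mu$ on $E$ with $\mu(N)=0$, the set $\{\omega\in\Omega: X_t(\omega)\in\tilde E\text{ for all }t\ge 0\}$ has $\mathbf P^\mu$-outer measure $1$. Moreover, every $(\tilde P_t)$ as in (a) is the restriction of $(P_t)$ to $\tilde E$: $\tilde P_t(x,B)=P_t(x,B)$ for all $t\ge 0$, $x\in\tilde E$ and $B\in\tilde{\mathcal E}^u$. -/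

import Mathlib

open MeasureTheory ProbabilityTheory Set Filter
open scoped NNReal ENNReal

universe u

/-- The σ-algebra of universally measurable subsets of a topological space: the intersection, over
all finite Borel measures, of the completions of the Borel σ-algebra. -/
@[reducible]
def univMeas (E : Type u) [TopologicalSpace E] : MeasurableSpace E where
  MeasurableSet' s := ∀ μ : @Measure E (borel E), @IsFiniteMeasure E (borel E) μ →
    @NullMeasurableSet E (borel E) s μ
  measurableSet_empty := fun μ _ => @MeasurableSet.nullMeasurableSet E (borel E) μ ∅
    (@MeasurableSet.empty E (borel E))
  measurableSet_compl := fun _ hs μ hμ => @NullMeasurableSet.compl E (borel E) μ _ (hs μ hμ)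
  measurableSet_iUnion := fun _ hf μ hμ =>
    @NullMeasurableSet.iUnion E (borel E) μ _ _ _ (fun i => hf i μ hμ)

/-- A Radon topological space: one that is homeomorphic to a universally measurable subset of a
compact metric space. -/
def IsRadonSpace (E : Type u) [TopologicalSpace E] : Prop :=
  ∃ (K : Type u) (_ : MetricSpace K) (_ : CompactSpace K) (e : E → K),
    Topology.IsEmbedding e ∧ MeasurableSet[univMeas K] (range e)

/-- Kernels on `(E, 𝓔ᵘ)`. -/
abbrev UKernel (E : Type u) [TopologicalSpace E] : Type u :=
  @Kernel E E (univMeas E) (univMeas E)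

/-- A Markov transition function `(P_t)_{t ≥ 0}`: Markov kernels that satisfy the
Chapman–Kolmogorov equations. -/
structure IsTransitionFunction {E : Type u} {mE : MeasurableSpace E} (P : ℝ≥0 → Kernel E E) :
    Prop where
  markov : ∀ t, IsMarkovKernel (P t)
  chapman_kolmogorov : ∀ (t s : ℝ≥0) (x : E) (B : Set E), MeasurableSet B →
    P (t + s) x B = ∫⁻ y, P s y B ∂(P t x)

/-- A transition function is normal if `P_0(x, B) = 1_B(x)`. -/
def IsNormalTransition {E : Type u} {mE : MeasurableSpace E} (P : ℝ≥0 → Kernel E E) : Prop :=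
  ∀ (x : E) (B : Set E), MeasurableSet B → P 0 x B = B.indicator 1 x

/-- The process `X` is adapted to `𝒢` and, under `Pr`, has the (simple) Markov property
`Pr{f(X_{t+s}) | 𝒢_t} = P_s f(X_t)` for all bounded measurable `f`. -/
structure HasMarkovProperty {Ω E : Type u} {mΩ : MeasurableSpace Ω} {mE : MeasurableSpace E}
    (𝒢 : Filtration ℝ≥0 mΩ) (Pr : Measure Ω) (X : ℝ≥0 → Ω → E) (P : ℝ≥0 → Kernel E E) :
    Prop where
  adapted : ∀ t, Measurable[𝒢 t] (X t)
  markov : ∀ (t s : ℝ≥0) (f : E → ℝ), Measurable f → (∃ C : ℝ, ∀ x, |f x| ≤ C) →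
    Pr[fun ω => f (X (t + s) ω) | 𝒢 t] =ᵐ[Pr] fun ω => ∫ y, f y ∂(P s (X t ω))

/-- Right continuity of a path on `[0, ∞)`. -/
def IsRightContinuous {E : Type u} [TopologicalSpace E] (w : ℝ≥0 → E) : Prop :=
  ∀ t, ContinuousWithinAt w (Ici t) t

/-- The first of Meyer's hypotheses: for every probability law `μ` on `E` there is a right
continuous process on some filtered probability space, Markov with transition function `P` and
with initial law `μ`. -/
def HD1 {E : Type u} [TopologicalSpace E] (P : ℝ≥0 → UKernel E) : Prop :=
  ∀ μ : @Measure E (univMeas E), @IsProbabilityMeasure E (univMeas E) μ →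
    ∃ (Ω : Type u) (mΩ : MeasurableSpace Ω) (𝒢 : Filtration ℝ≥0 mΩ) (Pr : Measure Ω)
      (X : ℝ≥0 → Ω → E),
      IsProbabilityMeasure Pr ∧ (∀ ω, IsRightContinuous fun t => X t ω) ∧
      @Measure.map Ω E mΩ (univMeas E) (X 0) Pr = μ ∧
      HasMarkovProperty (mE := univMeas E) 𝒢 Pr X P

/-- The canonical path space: all right continuous maps `[0, ∞) → E`. -/
def PathSpace (E : Type u) [TopologicalSpace E] : Type u :=
  {w : ℝ≥0 → E // IsRightContinuous w}

/-- The coordinate process `X_t(ω) = ω(t)`. -/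
def coord {E : Type u} [TopologicalSpace E] (t : ℝ≥0) (ω : PathSpace E) : E := ω.1 t

/-- `𝓕ᵘ`, generated by the `f(X_t)` with `t ≥ 0` and `f` universally measurable. -/
instance pathMeasurableSpace (E : Type u) [TopologicalSpace E] : MeasurableSpace (PathSpace E) :=
  ⨆ t, (univMeas E).comap (coord t)

/-- `𝓕ᵘ_t`, generated by the `f(X_s)` with `0 ≤ s ≤ t` and `f` universally measurable. -/
def pathFiltration (E : Type u) [TopologicalSpace E] :
    Filtration ℝ≥0 (pathMeasurableSpace E) where
  seq t := ⨆ s ∈ Iic t, (univMeas E).comap (coord s)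
  mono' := fun _ _ h => biSup_mono fun _ hs => le_trans hs h
  le' := fun _ => iSup₂_le fun s _ => le_iSup (fun s => (univMeas E).comap (coord s)) s

/-- The laws `(𝐏ˣ)` turn path space, with its coordinate process, natural filtration and shifts,
into the canonical realization of `P`: under `𝐏ˣ` the coordinate process starts at `x` and is
Markov with transition function `P`. -/
structure IsCanonicalLaw {E : Type u} [TopologicalSpace E] (P : ℝ≥0 → UKernel E)
    (Q : E → Measure (PathSpace E)) : Prop where
  isProb : ∀ x, IsProbabilityMeasure (Q x)
  start : ∀ x, @Measure.map _ _ _ (univMeas E) (coord 0) (Q x) = @Measure.dirac E (univMeas E) x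
  markov : ∀ x, HasMarkovProperty (mE := univMeas E) (pathFiltration E) (Q x) coord P

theorem measurable_coord {E : Type u} [TopologicalSpace E] (t : ℝ≥0) :
    @Measurable _ _ _ (univMeas E) (coord (E := E) t) :=
  Measurable.of_comap_le (le_iSup (fun s => (univMeas E).comap (coord s)) t)

theorem measurable_coord_filtration {E : Type u} [TopologicalSpace E] {s t : ℝ≥0} (h : s ≤ t) :
    @Measurable _ _ (pathFiltration E t) (univMeas E) (coord (E := E) s) :=
  Measurable.of_comap_le
    (le_iSup₂_of_le (f := fun s (_ : s ∈ Iic t) => (univMeas E).comap (coord (E := E) s)) s h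
      le_rfl)

theorem integral_kernel_bdd {E : Type u} {mE : MeasurableSpace E} {K : Kernel E E}
    [IsMarkovKernel K] {f : E → ℝ} (hf : Measurable f) {C : ℝ} (hC : ∀ x, |f x| ≤ C) :
    Measurable (fun x => ∫ y, f y ∂(K x)) ∧ ∀ x, |∫ y, f y ∂(K x)| ≤ C := by
  refine ⟨(hf.stronglyMeasurable.integral_kernel).measurable, fun x => ?_⟩
  have := norm_integral_le_of_norm_le_const (μ := K x) (f := f) (C := C)
    (Eventually.of_forall fun y => by simpa using hC y)
  simpa using this

theorem integrable_of_bdd {Ω : Type u} {mΩ : MeasurableSpace Ω} {Pr : Measure Ω}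
    [IsFiniteMeasure Pr] {f : Ω → ℝ} (hf : Measurable f) {C : ℝ} (hC : ∀ x, |f x| ≤ C) :
    Integrable f Pr :=
  Integrable.of_bound hf.aestronglyMeasurable C (Eventually.of_forall fun y => by simpa using hC y)

/-- Integrated form of the Markov property. -/
theorem HasMarkovProperty.setIntegral_eq {Ω E : Type u} {mΩ : MeasurableSpace Ω}
    {mE : MeasurableSpace E} {𝒢 : Filtration ℝ≥0 mΩ} {Pr : Measure Ω} [IsProbabilityMeasure Pr]
    {X : ℝ≥0 → Ω → E} {P : ℝ≥0 → Kernel E E} (h : HasMarkovProperty 𝒢 Pr X P) {t s : ℝ≥0}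
    {f : E → ℝ} (hf : Measurable f) {C : ℝ} (hC : ∀ x, |f x| ≤ C) {A : Set Ω}
    (hA : MeasurableSet[𝒢 t] A) :
    ∫ ω in A, f (X (t + s) ω) ∂Pr = ∫ ω in A, ∫ y, f y ∂(P s (X t ω)) ∂Pr := by
  have hm : Measurable (X (t + s)) := (h.adapted (t + s)).mono (𝒢.le _) le_rfl
  have hi : Integrable (fun ω => f (X (t + s) ω)) Pr :=
    integrable_of_bdd (hf.comp hm) fun x => hC _
  rw [← setIntegral_condExp (𝒢.le t) hi hA]
  exact setIntegral_congr_ae (𝒢.le t _ hA) ((h.markov t s f hf ⟨C, hC⟩).mono fun _ hω _ => hω)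

/-- The canonical realization exists, by mapping the processes provided by `HD1` to path space. -/
theorem exists_isCanonicalLaw {E : Type u} [TopologicalSpace E] {P : ℝ≥0 → UKernel E}
    (hP : IsTransitionFunction P) (h : HD1 P) : ∃ Q, IsCanonicalLaw P Q := by
  let mE : MeasurableSpace E := univMeas E
  have key : ∀ x : E, ∃ Q : Measure (PathSpace E), IsProbabilityMeasure Q ∧
      Q.map (coord 0) = Measure.dirac x ∧
      HasMarkovProperty (pathFiltration E) Q coord P := by
    intro x
    obtain ⟨Ω, mΩ, 𝒢, Pr, X, hprob, hrc, hinit, hM⟩ := h (Measure.dirac x) inferInstance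
    have hX : ∀ t, Measurable (X t) := fun t => (hM.adapted t).mono (𝒢.le t) le_rfl
    let Φ : Ω → PathSpace E := fun ω => ⟨fun t => X t ω, hrc ω⟩
    have hΦ : Measurable Φ := by
      refine Measurable.of_le_map (iSup_le fun t => ?_)
      rintro _ ⟨B, hB, rfl⟩
      exact hX t hB
    have hΦt : ∀ t, Measurable[𝒢 t, pathFiltration E t] Φ := by
      intro t
      refine Measurable.of_le_map (iSup₂_le fun s hs => ?_)
      rintro _ ⟨B, hB, rfl⟩
      exact 𝒢.mono hs _ (hM.adapted s hB)
    have hQ : IsProbabilityMeasure (Pr.map Φ) :=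
      Measure.isProbabilityMeasure_map hΦ.aemeasurable
    refine ⟨Pr.map Φ, hQ, ?_, ?_⟩
    · rw [Measure.map_map (measurable_coord 0) hΦ, ← hinit]
      rfl
    · refine ⟨fun t => measurable_coord_filtration le_rfl, fun t s f hf ⟨C, hC⟩ => ?_⟩
      have := hP.markov s
      obtain ⟨hKm, hKb⟩ := integral_kernel_bdd (K := P s) hf hC
      have hfi : Measurable fun ω : PathSpace E => f (coord (t + s) ω) :=
        hf.comp (measurable_coord _)
      have hgi : Measurable fun ω : PathSpace E => ∫ y, f y ∂(P s (coord t ω)) :=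
        hKm.comp (measurable_coord _)
      symm
      refine ae_eq_condExp_of_forall_setIntegral_eq ((pathFiltration E).le t)
        (integrable_of_bdd hfi fun _ => hC _)
        (fun A _ _ => (integrable_of_bdd hgi fun _ => hKb _).integrableOn) ?_ ?_
      · intro A hA _
        have hA' := (pathFiltration E).le t _ hA
        rw [setIntegral_map hA' hgi.aestronglyMeasurable hΦ.aemeasurable,
          setIntegral_map hA' hfi.aestronglyMeasurable hΦ.aemeasurable]
        exact (hM.setIntegral_eq hf hC (hΦt t hA)).symm
      · exact (hKm.comp (measurable_coord_filtration le_rfl)).stronglyMeasurable.aestronglyMeasurable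
  choose Q h1 h2 h3 using key
  exact ⟨Q, h1, h2, h3⟩

/-- For `B ∈ 𝓕ᵘ`, the map `x ↦ 𝐏ˣ(B)` is universally measurable. -/
theorem IsCanonicalLaw.measurable {E : Type u} [TopologicalSpace E] {P : ℝ≥0 → UKernel E}
    (hP : IsTransitionFunction P) {Q : E → Measure (PathSpace E)} (hQ : IsCanonicalLaw P Q) :
    @Measurable _ _ (univMeas E) _ Q := by
  let mE : MeasurableSpace E := univMeas E
  have hprob := hQ.isProb
  have hmarkov := hP.markov
  have key : ∀ (T : Finset ℝ≥0) (B : ℝ≥0 → Set (PathSpace E)),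
      (∀ t ∈ T, MeasurableSet[mE.comap (coord t)] (B t)) →
      ∀ r : ℝ≥0, (∀ t ∈ T, t ≤ r) → ∀ g : E → ℝ, Measurable g → ∀ C : ℝ, (∀ x, |g x| ≤ C) →
      Measurable fun x => ∫ ω in ⋂ t ∈ T, B t, g (coord r ω) ∂(Q x) := by
    intro T
    induction T using Finset.induction_on_max with
    | empty =>
      intro B _ r _ g hg C hC
      obtain ⟨hKm, hKb⟩ := integral_kernel_bdd (K := P r) hg hC
      convert hKm using 2 with x
      have := (hQ.markov x).setIntegral_eq (t := 0) (s := r) hg hC MeasurableSet.univ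
      simp only [zero_add, Measure.restrict_univ] at this
      simp only [Finset.notMem_empty, iInter_of_empty, iInter_univ, Measure.restrict_univ]
      rw [this, ← integral_map (f := fun z => ∫ y, g y ∂(P r z)) (φ := coord 0)
        (measurable_coord 0).aemeasurable hKm.aestronglyMeasurable, hQ.start x,
        integral_dirac' _ _ hKm.stronglyMeasurable]
    | insert a T haT ih =>
      intro B hB r hr g hg C hC
      obtain ⟨hKm, hKb⟩ := integral_kernel_bdd (K := P (r - a)) hg hC
      obtain ⟨D, hD, hDB⟩ := hB a (Finset.mem_insert_self _ _)
      have har : a + (r - a) = r := add_tsub_cancel_of_le (hr a (Finset.mem_insert_self _ _))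
      have hT : MeasurableSet[pathFiltration E a] (⋂ t ∈ T, B t) := by
        refine Finset.measurableSet_biInter _ fun t ht => ?_
        obtain ⟨D', hD', h'⟩ := hB t (Finset.mem_insert_of_mem ht)
        rw [← h']
        exact measurable_coord_filtration (haT t ht).le hD'
      have hA : MeasurableSet[pathFiltration E a] (⋂ t ∈ insert a T, B t) := by
        rw [Finset.set_biInter_insert]
        refine MeasurableSet.inter ?_ hT
        rw [← hDB]
        exact measurable_coord_filtration le_rfl hD
      have := ih B (fun t ht => hB t (Finset.mem_insert_of_mem ht)) a (fun t ht => (haT t ht).le)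
        (D.indicator fun z => ∫ y, g y ∂(P (r - a) z)) (hKm.indicator hD) C (fun x => by
          by_cases hx : x ∈ D
          · simpa [hx] using hKb x
          · simpa [hx] using (abs_nonneg _).trans (hC x))
      convert this using 2 with x
      have h1 := (hQ.markov x).setIntegral_eq (s := r - a) hg hC hA
      rw [har] at h1
      rw [h1, Finset.set_biInter_insert, inter_comm,
        ← setIntegral_indicator ((pathFiltration E).le a _
          (by rw [← hDB]; exact measurable_coord_filtration le_rfl hD))]
      rw [← hDB]
      rfl
  refine Measurable.measure_of_isPiSystem_of_isProbabilityMeasure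
    (S := piiUnionInter (fun t => {s | MeasurableSet[mE.comap (coord t)] s}) univ) ?_ ?_ ?_
  · refine Eq.trans ?_ (generateFrom_piiUnionInter_measurableSet
      (fun t => mE.comap (coord (E := E) t)) univ).symm
    simp [pathMeasurableSpace, mE]
  · exact isPiSystem_piiUnionInter _ (fun t => @MeasurableSpace.isPiSystem_measurableSet _ (mE.comap (coord t))) _
  · rintro _ ⟨T, -, B, hB, rfl⟩
    have := key T B hB (T.sup id) (fun t ht => Finset.le_sup (f := id) ht) (fun _ => 1)
      measurable_const 1 (by simp)
    simp only [integral_const, smul_eq_mul, mul_one, measureReal_restrict_apply_univ] at this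
    have h2 := this.ennreal_ofReal
    simpa [Measure.real] using h2

/-- The laws `(𝐏ˣ)_{x ∈ E}` of the canonical realization of `P`. -/
noncomputable def canonicalLaw {E : Type u} [TopologicalSpace E] (P : ℝ≥0 → UKernel E)
    (hP : IsTransitionFunction P) (h : HD1 P) : @Kernel E (PathSpace E) (univMeas E) _ :=
  letI := univMeas E
  ⟨(exists_isCanonicalLaw hP h).choose, (exists_isCanonicalLaw hP h).choose_spec.measurable hP⟩

/-- `𝐏^μ = ∫ μ(dx) 𝐏ˣ`. -/
noncomputable def canonicalLawFrom {E : Type u} [TopologicalSpace E] (P : ℝ≥0 → UKernel E)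
    (hP : IsTransitionFunction P) (h : HD1 P) (μ : @Measure E (univMeas E)) :
    Measure (PathSpace E) :=
  letI := univMeas E
  μ.bind (canonicalLaw P hP h)

/-- `F` is quasi-absorbing: for every initial law `μ` carried by `F`, the set of paths that stay in
`F` forever has full `𝐏^μ`-outer measure. (The value of a Mathlib measure on an arbitrary set is
its outer measure.) -/
def IsQuasiAbsorbing {E : Type u} [TopologicalSpace E] (P : ℝ≥0 → UKernel E)
    (hP : IsTransitionFunction P) (h : HD1 P) (F : Set E) : Prop :=
  ∀ μ : @Measure E (univMeas E), @IsProbabilityMeasure E (univMeas E) μ → μ Fᶜ = 0 →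
    canonicalLawFrom P hP h μ {ω | ∀ t, coord t ω ∈ F} = 1

/-- The resolvent `U^α f(x) = ∫_0^∞ e^{-αt} P_t f(x) dt` of nonnegative functions. -/
noncomputable def markovResolvent {E : Type u} {mE : MeasurableSpace E} (P : ℝ≥0 → Kernel E E) (α : ℝ)
    (f : E → ℝ≥0∞) (x : E) : ℝ≥0∞ :=
  ∫⁻ t in Ioi (0 : ℝ), ENNReal.ofReal (Real.exp (-(α * t))) * ∫⁻ y, f y ∂(P t.toNNReal x)

/-- `N` is weakly `U`-negligible: `U^α 1_N = 0` outside `N` for one (equivalently all) `α > 0`. -/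
def IsWeaklyNegligible {E : Type u} {mE : MeasurableSpace E} (P : ℝ≥0 → Kernel E E) (N : Set E) :
    Prop :=
  ∃ α : ℝ, 0 < α ∧ ∀ x ∉ N, markovResolvent P α (N.indicator 1) x = 0

/-- The restriction of the resolvent to a subset `F`: `Ũ^α f = (U^α f')|_F`, where `f'` extends `f`.
When `Fᶜ` is weakly `U`-negligible the choice of `f'` does not matter; extension by zero is used. -/
noncomputable def restrictedResolvent {E : Type u} {mE : MeasurableSpace E} (P : ℝ≥0 → Kernel E E)
    (F : Set E) (α : ℝ) (f : F → ℝ≥0∞) (x : F) : ℝ≥0∞ :=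
  markovResolvent P α (Function.extend Subtype.val f 0) x

/-- `P'` is a Markov transition function on `(F, 𝓕ᵘ)`, where `F` has the subspace topology, that
satisfies `HD1` and whose resolvent is the restriction to `F` of the resolvent of `P`. -/
structure IsRestrictedHD1 {E : Type u} [TopologicalSpace E] (P : ℝ≥0 → UKernel E) (F : Set E)
    (P' : ℝ≥0 → UKernel F) : Prop where
  transition : IsTransitionFunction P'
  hd1 : HD1 P'
  resolvent_eq : ∀ α : ℝ, 0 < α → ∀ f : F → ℝ≥0∞, @Measurable _ _ (univMeas F) _ f →
    ∀ x : F, markovResolvent P' α f x = restrictedResolvent P F α f x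

/-! ### Universally measurable sets -/

/-! Write `F` for the complement of `N`. Given a restricted transition function `P'`, fix `x` in `F`
and a bounded continuous `f` on `E`. Then `P'_t f(x)` and `P_t f(x)` are bounded and right
continuous in `t`, because by `HD1` each is the expectation of `f` along right continuous paths.
They have the same Laplace transform: weak negligibility makes `N` null for `P_t(x, ·)` at almost
every `t`, so extending `f|_F` by zero loses nothing. Hence they agree for every `t`
(`eq_of_laplace_eq`), and the inclusion maps `P'_t(x, ·)` to `P_t(x, ·)`
(`IsRestrictedHD1.map_val_eq`). This already gives the uniqueness claim.

For (a) ⇒ (b), an `F`-valued realization of `P'`, viewed in `E`, is then Markov for `P`. By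
`HasMarkovProperty.law_unique` its path law is the canonical one. Since all its paths stay in `F`,
every measurable set containing the paths in `F` has full probability.

For (b) ⇒ (a), full outer measure allows the canonical law to be traced on the possibly
nonmeasurable set of paths in `F` (`map_traceMeasure`). The coordinate process there is the right
continuous process that `HD1` requires. Starting from point masses, (b) also gives `P_t(x, N) = 0`
for every `t`, so the restricted kernels are Markov. -/

theorem borel_le_univMeas (E : Type u) [TopologicalSpace E] : borel E ≤ univMeas E :=
  fun _ hs μ _ => @MeasurableSet.nullMeasurableSet E (borel E) μ _ hs

theorem Continuous.measurable_univMeas {E F : Type u} [TopologicalSpace E] [TopologicalSpace F]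
    {f : F → E} (hf : Continuous f) : @Measurable F E (univMeas F) (univMeas E) f := by
  intro s hs μ hμ
  let bE : MeasurableSpace E := borel E
  let bF : MeasurableSpace F := borel F
  have : BorelSpace E := ⟨rfl⟩
  have : BorelSpace F := ⟨rfl⟩
  have hfm : Measurable f := hf.measurable
  exact (hs (μ.map f) (Measure.isFiniteMeasure_map μ f)).preimage
    (hfm.quasiMeasurePreserving μ)

/-- A finite Borel measure on `E` pulls back to a finite Borel measure on `F`, because Borel sets of
`F` are traces of Borel sets of `E` and `F` is null measurable. Testing `B` against the pullback
decides its image. -/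
theorem measurableSet_image_val_univMeas {E : Type u} [TopologicalSpace E] {F : Set E}
    (hF : MeasurableSet[univMeas E] F) {B : Set F} (hB : MeasurableSet[univMeas F] B) :
    MeasurableSet[univMeas E] (Subtype.val '' B) := by
  intro μ hμ
  let bE : MeasurableSpace E := borel E
  let bF : MeasurableSpace F := borel F
  have himg : ∀ s : Set F, MeasurableSet s →
      NullMeasurableSet ((Subtype.val : F → E) '' s) μ := by
    intro s hs
    have hs' : MeasurableSet[bE.comap Subtype.val] s := by
      have h : bF = bE.comap Subtype.val := borel_comap
      rwa [← h]
    obtain ⟨A, hA, rfl⟩ := hs'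
    rw [Subtype.image_preimage_coe]
    exact (hF μ hμ).inter hA.nullMeasurableSet
  refine Measure.NullMeasurableSet.image _ μ Subtype.val_injective himg (hB _ ⟨?_⟩)
  rw [Measure.comap_apply₀ _ _ Subtype.val_injective himg MeasurableSet.univ.nullMeasurableSet]
  exact measure_lt_top _ _

theorem measurableEmbedding_val_univMeas {E : Type u} [TopologicalSpace E] {F : Set E}
    (hF : MeasurableSet[univMeas E] F) :
    @MeasurableEmbedding F E (univMeas F) (univMeas E) Subtype.val :=
  @MeasurableEmbedding.mk F E (univMeas F) (univMeas E) _ Subtype.val_injective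
    continuous_subtype_val.measurable_univMeas
    fun _ hB => measurableSet_image_val_univMeas hF hB

/-- A finite measure on the universally measurable sets is determined by its values on the Borel
sets. -/
theorem measure_univMeas_ext {E : Type u} [TopologicalSpace E] {μ ν : @Measure E (univMeas E)}
    [IsFiniteMeasure μ]
    (h : @Measure.trim E (borel E) (univMeas E) μ (borel_le_univMeas E) =
      @Measure.trim E (borel E) (univMeas E) ν (borel_le_univMeas E)) : μ = ν := by
  have hle := borel_le_univMeas E
  refine @Measure.ext E (univMeas E) _ _ fun s hs => ?_
  -- The Borel set `A` differs from `s` by a null set of the common trim, which is null for both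
  -- measures.
  obtain ⟨A, hA, hAs⟩ := hs (μ.trim hle) (isFiniteMeasure_trim hle)
  have h1 := ae_eq_of_ae_eq_trim hAs
  rw [h] at hAs
  have h2 := ae_eq_of_ae_eq_trim hAs
  rw [measure_congr h1, measure_congr h2, ← trim_measurableSet_eq hle hA,
    ← trim_measurableSet_eq hle hA, h]

/-! ### The trace of a measure on a set of full outer measure -/

/-- The trace of `μ` on a possibly nonmeasurable set `S`, given by the restriction of the outer
measure. -/
noncomputable def traceMeasure {Ω : Type u} {mΩ : MeasurableSpace Ω} (μ : Measure Ω) (S : Set Ω) :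
    @Measure S (mΩ.comap Subtype.val) :=
  letI : MeasurableSpace S := mΩ.comap Subtype.val
  (OuterMeasure.comap Subtype.val μ.toOuterMeasure).toMeasure <| by
    rintro _ ⟨A, hA, rfl⟩
    refine (OuterMeasure.isCaratheodory_iff _).2 fun T => ?_
    simp only [OuterMeasure.comap_apply, Measure.coe_toOuterMeasure, image_inter_preimage,
      image_sdiff_preimage]
    exact (measure_inter_add_sdiff _ hA).symm

/-- A measurable `A` splits both `S` and the whole space. The pieces of `S` are no larger and the
totals agree, so by finiteness `S ∩ A` has the outer measure of `A`. -/
theorem map_traceMeasure {Ω : Type u} {mΩ : MeasurableSpace Ω} {μ : Measure Ω}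
    [IsFiniteMeasure μ] {S : Set Ω} (hS : μ S = μ univ) :
    @Measure.map S Ω (mΩ.comap Subtype.val) mΩ Subtype.val (traceMeasure μ S) = μ := by
  let mS : MeasurableSpace S := mΩ.comap Subtype.val
  have hval : Measurable (Subtype.val : S → Ω) := comap_measurable _
  ext A hA
  rw [Measure.map_apply hval hA, traceMeasure, toMeasure_apply _ _ (hval hA)]
  simp only [OuterMeasure.comap_apply, Measure.coe_toOuterMeasure, Subtype.image_preimage_coe]
  have h1 := measure_inter_add_sdiff S hA (μ := μ)
  have h2 := measure_inter_add_sdiff univ hA (μ := μ)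
  have h3 : μ (S \ A) ≤ μ (univ \ A) := measure_mono (sdiff_subset_sdiff_left (subset_univ _))
  have h4 : μ (S ∩ A) ≤ μ A := measure_mono inter_subset_right
  refine le_antisymm h4 ?_
  rw [hS, ← h2, univ_inter] at h1
  by_contra! hlt
  exact absurd h1 (ENNReal.add_lt_add_of_lt_of_le (measure_ne_top _ _) hlt h3).ne

/-! ### Markov processes -/

theorem HasMarkovProperty.of_setIntegral_eq {Ω E : Type u} {mΩ : MeasurableSpace Ω}
    {mE : MeasurableSpace E} {𝒢 : Filtration ℝ≥0 mΩ} {Pr : Measure Ω} [IsProbabilityMeasure Pr]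
    {X : ℝ≥0 → Ω → E} {P : ℝ≥0 → Kernel E E} (hP : ∀ t, IsMarkovKernel (P t))
    (hX : ∀ t, Measurable[𝒢 t] (X t))
    (h : ∀ (t s : ℝ≥0) (f : E → ℝ), Measurable f → ∀ C : ℝ, (∀ x, |f x| ≤ C) →
      ∀ A, MeasurableSet[𝒢 t] A →
        ∫ ω in A, f (X (t + s) ω) ∂Pr = ∫ ω in A, ∫ y, f y ∂(P s (X t ω)) ∂Pr) :
    HasMarkovProperty 𝒢 Pr X P := by
  refine ⟨hX, fun t s f hf ⟨C, hC⟩ => ?_⟩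
  have := hP s
  obtain ⟨hKm, hKb⟩ := integral_kernel_bdd (K := P s) hf hC
  have hXm : ∀ t, Measurable (X t) := fun t => (hX t).mono (𝒢.le t) le_rfl
  symm
  refine ae_eq_condExp_of_forall_setIntegral_eq (𝒢.le t)
    (integrable_of_bdd (hf.comp (hXm _)) fun _ => hC _)
    (fun A _ _ => (integrable_of_bdd (hKm.comp (hXm t)) fun _ => hKb _).integrableOn)
    (fun A hA _ => (h t s f hf C hC A hA).symm) ?_
  exact (hKm.comp (hX t)).stronglyMeasurable.aestronglyMeasurable

theorem HasMarkovProperty.map {Ω Ω' E : Type u} {mΩ : MeasurableSpace Ω}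
    {mΩ' : MeasurableSpace Ω'} {mE : MeasurableSpace E} {𝒢 : Filtration ℝ≥0 mΩ}
    {𝒢' : Filtration ℝ≥0 mΩ'} {Pr : Measure Ω} [IsProbabilityMeasure Pr]
    {X : ℝ≥0 → Ω → E} {X' : ℝ≥0 → Ω' → E} {P : ℝ≥0 → Kernel E E}
    (hP : ∀ t, IsMarkovKernel (P t)) (h : HasMarkovProperty 𝒢 Pr X P) {Φ : Ω → Ω'}
    (hΦ : Measurable Φ) (hΦt : ∀ t, Measurable[𝒢 t, 𝒢' t] Φ)
    (hX' : ∀ t, Measurable[𝒢' t] (X' t)) (hXX' : ∀ t ω, X' t (Φ ω) = X t ω) :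
    HasMarkovProperty 𝒢' (Pr.map Φ) X' P := by
  have : IsProbabilityMeasure (Pr.map Φ) := Measure.isProbabilityMeasure_map hΦ.aemeasurable
  have hX'm : ∀ t, Measurable (X' t) := fun t => (hX' t).mono (𝒢'.le t) le_rfl
  refine .of_setIntegral_eq hP hX' fun t s f hf C hC A hA => ?_
  have := hP s
  obtain ⟨hKm, -⟩ := integral_kernel_bdd (K := P s) hf hC
  have h1 : Measurable fun ω => f (X' (t + s) ω) := hf.comp (hX'm _)
  have h2 : Measurable fun ω => ∫ y, f y ∂(P s (X' t ω)) := hKm.comp (hX'm _)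
  rw [setIntegral_map (𝒢'.le t _ hA) h1.aestronglyMeasurable hΦ.aemeasurable,
    setIntegral_map (𝒢'.le t _ hA) h2.aestronglyMeasurable hΦ.aemeasurable]
  simp only [hXX']
  exact h.setIntegral_eq hf hC (hΦt t hA)

/-- The law on path space of a Markov process is determined by its initial law and its transition
function. -/
theorem HasMarkovProperty.law_unique {E : Type u} [TopologicalSpace E] {P : ℝ≥0 → UKernel E}
    (hP : ∀ t, IsMarkovKernel (P t)) {Q₁ Q₂ : Measure (PathSpace E)} [IsProbabilityMeasure Q₁]
    [IsProbabilityMeasure Q₂]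
    (h₁ : HasMarkovProperty (mE := univMeas E) (pathFiltration E) Q₁ coord P)
    (h₂ : HasMarkovProperty (mE := univMeas E) (pathFiltration E) Q₂ coord P)
    (h0 : @Measure.map _ _ _ (univMeas E) (coord 0) Q₁ =
      @Measure.map _ _ _ (univMeas E) (coord 0) Q₂) : Q₁ = Q₂ := by
  let mE : MeasurableSpace E := univMeas E
  -- The extra factor `g` at a time `r` after all of `T` makes the induction close. Conditioning at
  -- the largest time `a` turns `1_D(X_a) g(X_r)` into `(1_D · P_{r-a} g)(X_a)`, which has the same
  -- form over one time fewer.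
  have key : ∀ (T : Finset ℝ≥0) (B : ℝ≥0 → Set (PathSpace E)),
      (∀ t ∈ T, MeasurableSet[mE.comap (coord t)] (B t)) →
      ∀ r : ℝ≥0, (∀ t ∈ T, t ≤ r) → ∀ g : E → ℝ, Measurable g → ∀ C : ℝ, (∀ x, |g x| ≤ C) →
      ∫ ω in ⋂ t ∈ T, B t, g (coord r ω) ∂Q₁ = ∫ ω in ⋂ t ∈ T, B t, g (coord r ω) ∂Q₂ := by
    intro T
    induction T using Finset.induction_on_max with
    | empty =>
      -- With no times left, the Markov property at time 0 reduces everything to the initial law.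
      intro B _ r _ g hg C hC
      obtain ⟨hKm, hKb⟩ := integral_kernel_bdd (K := P r) hg hC
      have e₁ := h₁.setIntegral_eq (t := 0) (s := r) hg hC MeasurableSet.univ
      have e₂ := h₂.setIntegral_eq (t := 0) (s := r) hg hC MeasurableSet.univ
      simp only [zero_add, Measure.restrict_univ] at e₁ e₂
      simp only [Finset.notMem_empty, iInter_of_empty, iInter_univ, Measure.restrict_univ]
      rw [e₁, e₂, ← integral_map (f := fun z => ∫ y, g y ∂(P r z)) (φ := coord 0)
        (measurable_coord 0).aemeasurable hKm.aestronglyMeasurable, h0,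
        integral_map (measurable_coord 0).aemeasurable hKm.aestronglyMeasurable]
    | insert a T haT ih =>
      intro B hB r hr g hg C hC
      obtain ⟨hKm, hKb⟩ := integral_kernel_bdd (K := P (r - a)) hg hC
      obtain ⟨D, hD, hDB⟩ := hB a (Finset.mem_insert_self _ _)
      have har : a + (r - a) = r := add_tsub_cancel_of_le (hr a (Finset.mem_insert_self _ _))
      have hBa : MeasurableSet[pathFiltration E a] (coord a ⁻¹' D) :=
        measurable_coord_filtration le_rfl hD
      have hA : MeasurableSet[pathFiltration E a] (⋂ t ∈ insert a T, B t) := by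
        refine Finset.measurableSet_biInter _ fun t ht => ?_
        obtain ⟨D', hD', h'⟩ := hB t ht
        have hta : t ≤ a := by
          rcases Finset.mem_insert.1 ht with rfl | ht
          exacts [le_rfl, (haT t ht).le]
        rw [← h']
        exact measurable_coord_filtration hta hD'
      have e := ih B (fun t ht => hB t (Finset.mem_insert_of_mem ht)) a (fun t ht => (haT t ht).le)
        (D.indicator fun z => ∫ y, g y ∂(P (r - a) z)) (hKm.indicator hD) C (fun x => by
          by_cases hx : x ∈ D
          · simpa [hx] using hKb x
          · simpa [hx] using (abs_nonneg _).trans (hC x))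
      have step : ∀ {Q : Measure (PathSpace E)} [IsProbabilityMeasure Q],
          HasMarkovProperty (pathFiltration E) Q coord P →
          ∫ ω in ⋂ t ∈ insert a T, B t, g (coord r ω) ∂Q = ∫ ω in ⋂ t ∈ T, B t,
            (D.indicator fun z => ∫ y, g y ∂(P (r - a) z)) (coord a ω) ∂Q := by
        intro Q _ hQ
        have h1 := hQ.setIntegral_eq (s := r - a) hg hC hA
        rw [har] at h1
        rw [h1, Finset.set_biInter_insert, inter_comm, ← hDB,
          ← setIntegral_indicator ((pathFiltration E).le a _ hBa)]
        rfl
      rw [step h₁, step h₂, e]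
  refine ext_of_generate_finite
    (piiUnionInter (fun t => {s | MeasurableSet[mE.comap (coord t)] s}) univ) ?_ ?_ ?_ ?_
  · refine Eq.trans ?_ (generateFrom_piiUnionInter_measurableSet
      (fun t => mE.comap (coord (E := E) t)) univ).symm
    simp [pathMeasurableSpace, mE]
  · exact isPiSystem_piiUnionInter _
      (fun t => @MeasurableSpace.isPiSystem_measurableSet _ (mE.comap (coord t))) _
  · rintro _ ⟨T, -, B, hB, rfl⟩
    have := key T B hB (T.sup id) (fun t ht => Finset.le_sup (f := id) ht) (fun _ => 1)
      measurable_const 1 (by simp)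
    simpa [Measure.real, ENNReal.toReal_eq_toReal_iff'] using this
  · simp

theorem isCanonicalLaw_canonicalLaw {E : Type u} [TopologicalSpace E] {P : ℝ≥0 → UKernel E}
    (hP : IsTransitionFunction P) (h : HD1 P) :
    IsCanonicalLaw P fun x => canonicalLaw P hP h x :=
  (exists_isCanonicalLaw hP h).choose_spec

theorem isProbabilityMeasure_canonicalLawFrom {E : Type u} [TopologicalSpace E]
    {P : ℝ≥0 → UKernel E} (hP : IsTransitionFunction P) (h : HD1 P)
    (μ : @Measure E (univMeas E)) [IsProbabilityMeasure μ] :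
    IsProbabilityMeasure (canonicalLawFrom P hP h μ) := by
  let mE : MeasurableSpace E := univMeas E
  have : IsMarkovKernel (canonicalLaw P hP h) := ⟨(isCanonicalLaw_canonicalLaw hP h).isProb⟩
  unfold canonicalLawFrom
  infer_instance

theorem map_coord_zero_canonicalLawFrom {E : Type u} [TopologicalSpace E]
    {P : ℝ≥0 → UKernel E} (hP : IsTransitionFunction P) (h : HD1 P)
    (μ : @Measure E (univMeas E)) :
    @Measure.map _ _ _ (univMeas E) (coord 0) (canonicalLawFrom P hP h μ) = μ := by
  let mE : MeasurableSpace E := univMeas E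
  ext B hB
  rw [Measure.map_apply (measurable_coord 0) hB, canonicalLawFrom,
    Measure.bind_apply (measurable_coord 0 hB) (Kernel.aemeasurable _)]
  have e : ∀ x, canonicalLaw P hP h x (coord 0 ⁻¹' B) = B.indicator 1 x := fun x => by
    rw [← Measure.map_apply (measurable_coord 0) hB, (isCanonicalLaw_canonicalLaw hP h).start x,
      Measure.dirac_apply' _ hB]
  simp [e, lintegral_indicator_one hB]

/-- The integrated Markov property is linear in the law, so it passes from each `𝐏ˣ` to their
mixture. -/
theorem hasMarkovProperty_canonicalLawFrom {E : Type u} [TopologicalSpace E]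
    {P : ℝ≥0 → UKernel E} (hP : IsTransitionFunction P) (h : HD1 P)
    (μ : @Measure E (univMeas E)) [IsProbabilityMeasure μ] :
    HasMarkovProperty (mE := univMeas E) (pathFiltration E) (canonicalLawFrom P hP h μ)
      coord P := by
  let mE : MeasurableSpace E := univMeas E
  have hc := isCanonicalLaw_canonicalLaw hP h
  have := hc.isProb
  have : IsMarkovKernel (canonicalLaw P hP h) := ⟨hc.isProb⟩
  have := isProbabilityMeasure_canonicalLawFrom hP h μ
  refine .of_setIntegral_eq hP.markov (fun t => measurable_coord_filtration le_rfl)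
    fun t s f hf C hC A hA => ?_
  have := hP.markov s
  have hA' := (pathFiltration E).le t _ hA
  obtain ⟨hKm, hKb⟩ := integral_kernel_bdd (K := P s) hf hC
  have bind_eq : ∀ {g : E → ℝ} (r : ℝ≥0), Measurable g → (∀ x, |g x| ≤ C) →
      ∫ ω in A, g (coord r ω) ∂(canonicalLawFrom P hP h μ) =
        ∫ x, ∫ ω in A, g (coord r ω) ∂(canonicalLaw P hP h x) ∂μ := by
    intro g r hg hgC
    have hgm : Measurable fun ω : PathSpace E => g (coord r ω) := hg.comp (measurable_coord r)
    have hi : Integrable (A.indicator fun ω => g (coord r ω)) (μ.bind (canonicalLaw P hP h)) :=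
      (integrable_of_bdd (Pr := canonicalLawFrom P hP h μ) hgm fun _ => hgC _).indicator hA'
    simp only [← integral_indicator hA']
    rw [Measure.comp_eq_comp_const_apply] at hi
    rw [canonicalLawFrom, Measure.comp_eq_comp_const_apply]
    exact Kernel.integral_comp hi
  rw [bind_eq (t + s) hf hC, bind_eq (g := fun z => ∫ y, f y ∂(P s z)) t hKm hKb]
  exact integral_congr_ae (Eventually.of_forall fun x => (hc.markov x).setIntegral_eq hf hC hA)

/-! ### Right continuous processes -/

/-- Right continuity makes the process a pointwise limit of processes that sample only countably
many times. -/
theorem measurable_uncurry_of_isRightContinuous {Ω E : Type u} [MeasurableSpace Ω]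
    [TopologicalSpace E] [TopologicalSpace.PseudoMetrizableSpace E] [MeasurableSpace E]
    [BorelSpace E] {X : ℝ≥0 → Ω → E} (hrc : ∀ ω, IsRightContinuous fun t => X t ω)
    (hX : ∀ t, Measurable (X t)) : Measurable (Function.uncurry X) := by
  -- The first multiple of `1/(n+1)` strictly after `t`: it approaches `t` from the right.
  let d : ℕ → ℝ≥0 → ℝ≥0 := fun n t => (⌊(n + 1) * t⌋₊ + 1) / (n + 1)
  have hd1 : ∀ n t, t ≤ d n t := fun n t => by
    rw [le_div_iff₀ (by positivity), mul_comm]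
    exact (Nat.lt_floor_add_one _).le
  have hd2 : ∀ n t, d n t ≤ t + 1 / (n + 1) := fun n t => by
    have hn : (n + 1 : ℝ≥0) ≠ 0 := by positivity
    calc d n t ≤ ((n + 1) * t + 1) / (n + 1) := by
          simp only [d]
          gcongr
          exact Nat.floor_le zero_le
      _ = t + 1 / (n + 1) := by rw [add_div, mul_div_cancel_left₀ _ hn]
  refine measurable_of_tendsto_metrizable (f := fun n p => X (d n p.1) p.2) (fun n => ?_) ?_
  · have h1 : Measurable fun p : ℕ × Ω => X ((p.1 + 1) / (n + 1)) p.2 :=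
      measurable_from_prod_countable_right fun k => hX ((k + 1) / (n + 1))
    have h2 : Measurable fun p : ℝ≥0 × Ω => (⌊((n : ℝ≥0) + 1) * p.1⌋₊, p.2) :=
      (Nat.measurable_floor.comp (measurable_const.mul measurable_fst)).prodMk measurable_snd
    have h3 := h1.comp h2
    simp only [Function.comp_def] at h3
    exact h3
  · refine tendsto_pi_nhds.2 fun p => ?_
    refine (hrc p.2 p.1).tendsto.comp (tendsto_nhdsWithin_iff.2 ⟨?_, .of_forall fun n => hd1 n _⟩)
    refine tendsto_of_tendsto_of_tendsto_of_le_of_le tendsto_const_nhds ?_ (fun n => hd1 n p.1)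
      fun n => hd2 n p.1
    have := (tendsto_one_div_add_atTop_nhds_zero_nat (𝕜 := ℝ≥0)).const_add p.1
    simpa using this

/-! ### Regularity in time of transition functions satisfying `HD1` -/

/-- Started at `x`, the Markov property at time 0 identifies the law of `X_t` with `P_t(x, ·)`.
Regularity of the paths thus becomes regularity of `P_t(x, ·)` in `t`. -/
theorem HD1.exists_process {E : Type u} [TopologicalSpace E] {P : ℝ≥0 → UKernel E}
    (hP : IsTransitionFunction P) (h : HD1 P) (x : E) :
    ∃ (Ω : Type u) (_ : MeasurableSpace Ω) (Pr : Measure Ω) (X : ℝ≥0 → Ω → E),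
      IsProbabilityMeasure Pr ∧ (∀ ω, IsRightContinuous fun t => X t ω) ∧
      (∀ t, @Measurable _ _ _ (univMeas E) (X t)) ∧
      ∀ t, @Measure.map _ _ _ (univMeas E) (X t) Pr = P t x := by
  let mE : MeasurableSpace E := univMeas E
  obtain ⟨Ω, mΩ, 𝒢, Pr, X, hprob, hrc, hinit, hM⟩ := h (Measure.dirac x) inferInstance
  have hX : ∀ t, Measurable (X t) := fun t => (hM.adapted t).mono (𝒢.le t) le_rfl
  refine ⟨Ω, mΩ, Pr, X, hprob, hrc, hX, fun t => ?_⟩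
  have := hP.markov t
  have : IsProbabilityMeasure (Pr.map (X t)) :=
    Measure.isProbabilityMeasure_map (hX t).aemeasurable
  ext B hB
  have hf : Measurable (B.indicator fun _ => (1 : ℝ)) := measurable_const.indicator hB
  have hC : ∀ y, |B.indicator (fun _ => (1 : ℝ)) y| ≤ 1 := fun y => by
    by_cases hy : y ∈ B <;> simp [hy]
  obtain ⟨hKm, -⟩ := integral_kernel_bdd (K := P t) hf hC
  have e := hM.setIntegral_eq (t := 0) (s := t) hf hC MeasurableSet.univ
  simp only [zero_add, Measure.restrict_univ] at e
  rw [← integral_map (f := B.indicator fun _ => (1 : ℝ)) (hX t).aemeasurable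
      hf.aestronglyMeasurable,
    ← integral_map (f := fun z => ∫ y, B.indicator (fun _ => (1 : ℝ)) y ∂(P t z))
      (hX 0).aemeasurable hKm.aestronglyMeasurable, hinit,
    integral_dirac' _ _ hKm.stronglyMeasurable, integral_indicator_const _ hB,
    integral_indicator_const _ hB] at e
  simpa [Measure.real, ENNReal.toReal_eq_toReal_iff'] using e

theorem Measurable.univMeas_of_borel {E : Type u} [TopologicalSpace E] {β : Type*}
    [MeasurableSpace β] {g : E → β} (hg : @Measurable _ _ (borel E) _ g) :
    @Measurable _ _ (univMeas E) _ g :=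
  fun _ hs => borel_le_univMeas E _ (hg hs)

theorem HD1.isRightContinuous_lintegral {E : Type u} [TopologicalSpace E] {P : ℝ≥0 → UKernel E}
    (hP : IsTransitionFunction P) (h : HD1 P) (x : E) (f : BoundedContinuousFunction E ℝ≥0) :
    IsRightContinuous fun t => @lintegral E (univMeas E) (P t x) fun y => f y := by
  let mE : MeasurableSpace E := univMeas E
  obtain ⟨Ω, mΩ, Pr, X, hprob, hrc, hX, hmap⟩ := h.exists_process hP x
  have hf : Measurable fun y => (f y : ℝ≥0∞) :=
    Measurable.univMeas_of_borel (ENNReal.continuous_coe.comp f.continuous).borel_measurable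
  have e : ∀ t, ∫⁻ y, f y ∂(P t x) = ∫⁻ ω, f (X t ω) ∂Pr := fun t => by
    rw [← hmap t, lintegral_map hf (hX t)]
  intro t
  simp only [ContinuousWithinAt, e]
  refine tendsto_lintegral_filter_of_dominated_convergence (fun _ => (nndist f 0 : ℝ≥0∞))
    (.of_forall fun s => hf.comp (hX s)) (.of_forall fun s => .of_forall fun ω => ?_) (by simp)
    (.of_forall fun ω => ?_)
  · exact ENNReal.coe_le_coe.2 (BoundedContinuousFunction.NNReal.upper_bound f _)
  · exact (((ENNReal.continuous_coe.comp f.continuous).tendsto _).comp (hrc ω t).tendsto)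

theorem HD1.measurable_lintegral {E : Type u} [TopologicalSpace E]
    [TopologicalSpace.PseudoMetrizableSpace E] {P : ℝ≥0 → UKernel E}
    (hP : IsTransitionFunction P) (h : HD1 P) (x : E) {g : E → ℝ≥0∞}
    (hg : @Measurable _ _ (borel E) _ g) :
    Measurable fun t => @lintegral E (univMeas E) (P t x) g := by
  obtain ⟨Ω, mΩ, Pr, X, hprob, hrc, hX, hmap⟩ := h.exists_process hP x
  have e : ∀ t, @lintegral E (univMeas E) (P t x) g = ∫⁻ ω, g (X t ω) ∂Pr := fun t => by
    rw [← hmap t, @lintegral_map _ _ _ (univMeas E) _ _ _ hg.univMeas_of_borel (hX t)]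
  simp only [e]
  let bE : MeasurableSpace E := borel E
  have : BorelSpace E := ⟨rfl⟩
  have hm := measurable_uncurry_of_isRightContinuous hrc
    fun t => (hX t).mono le_rfl (borel_le_univMeas E)
  exact (hg.comp hm).lintegral_prod_right'

/-- Joint measurability of the process is only Borel. For universally measurable `B` the preimage in
time × sample space is null measurable for the product measure; Fubini then replaces it by a
measurable set in almost every section. -/
theorem HD1.aemeasurable_apply {E : Type u} [TopologicalSpace E]
    [TopologicalSpace.PseudoMetrizableSpace E] {P : ℝ≥0 → UKernel E}
    (hP : IsTransitionFunction P) (h : HD1 P) (x : E) {B : Set E}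
    (hB : MeasurableSet[univMeas E] B) (ρ : Measure ℝ≥0) [SFinite ρ] :
    AEMeasurable (fun t => P t x B) ρ := by
  obtain ⟨Ω, mΩ, Pr, X, hprob, hrc, hX, hmap⟩ := h.exists_process hP x
  have e : ∀ t, P t x B = Pr (X t ⁻¹' B) := fun t => by
    rw [← hmap t, @Measure.map_apply _ _ _ (univMeas E) _ _ (hX t) _ hB]
  simp only [e]
  let bE : MeasurableSpace E := borel E
  have : BorelSpace E := ⟨rfl⟩
  have hm := measurable_uncurry_of_isRightContinuous hrc
    fun t => (hX t).mono le_rfl (borel_le_univMeas E)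
  -- Universal measurability is tested on finite measures, hence `ρ.toFinite`, which dominates `ρ`.
  have hnull : NullMeasurableSet (Function.uncurry X ⁻¹' B) (ρ.toFinite.prod Pr) :=
    (hB ((ρ.toFinite.prod Pr).map (Function.uncurry X))
      (Measure.isFiniteMeasure_map _ _)).preimage (hm.quasiMeasurePreserving _)
  obtain ⟨A, hA, hBA⟩ := hnull
  refine ⟨fun t => Pr (Prod.mk t ⁻¹' A), measurable_measure_prodMk_left hA, ?_⟩
  filter_upwards [absolutelyContinuous_toFinite ρ (Measure.ae_ae_of_ae_prod hBA)] with t ht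
  exact measure_congr ht

/-- The resolvent is an integral with positive weight, so its vanishing forces the almost everywhere
measurable integrand to vanish almost everywhere. -/
theorem IsWeaklyNegligible.ae_eq_zero {E : Type u} [TopologicalSpace E]
    [TopologicalSpace.PseudoMetrizableSpace E] {P : ℝ≥0 → UKernel E}
    (hP : IsTransitionFunction P) (h : HD1 P) {N : Set E} (hN : MeasurableSet[univMeas E] N)
    (hneg : IsWeaklyNegligible (mE := univMeas E) P N) {x : E} (hx : x ∉ N) :
    ∀ᵐ t : ℝ ∂volume.restrict (Ioi 0), P t.toNNReal x N = 0 := by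
  let mE : MeasurableSpace E := univMeas E
  obtain ⟨α, -, hα⟩ := hneg
  have h0 := hα x hx
  simp only [markovResolvent, lintegral_indicator_one hN] at h0
  have hm : AEMeasurable (fun t : ℝ => P t.toNNReal x N) (volume.restrict (Ioi 0)) :=
    (h.aemeasurable_apply hP x hN
      ((volume.restrict (Ioi (0 : ℝ))).map Real.toNNReal)).comp_measurable measurable_real_toNNReal
  have hexp : AEMeasurable (fun t : ℝ => ENNReal.ofReal (Real.exp (-(α * t))))
    (volume.restrict (Ioi 0)) := by fun_prop
  replace h0 := (lintegral_eq_zero_iff' (hexp.mul hm)).1 h0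
  filter_upwards [h0] with t ht
  exact (mul_eq_zero.1 ht).resolve_left (by simp [Real.exp_pos])

/-! ### Uniqueness of Laplace transforms -/

/-- A finite measure on `[0, ∞)` is determined by the values of its Laplace transform at the
natural numbers. -/
theorem measure_nnreal_ext_of_lintegral_exp {m₁ m₂ : Measure ℝ≥0} [IsFiniteMeasure m₁]
    [IsFiniteMeasure m₂]
    (h : ∀ n : ℕ, ∫⁻ t, ENNReal.ofReal (Real.exp (-(n * t))) ∂m₁ =
      ∫⁻ t, ENNReal.ofReal (Real.exp (-(n * t))) ∂m₂) : m₁ = m₂ := by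
  let e : BoundedContinuousFunction ℝ≥0 ℝ :=
    BoundedContinuousFunction.ofNormedAddCommGroup (fun t => Real.exp (-t)) (by fun_prop) 1
      fun t => by simp
  -- Polynomials in `e^{-t}`: they separate points, and their integrals are combinations of Laplace
  -- transforms at natural numbers, with `n = 0` giving the total mass.
  let A : StarSubalgebra ℝ (BoundedContinuousFunction ℝ≥0 ℝ) :=
    { Algebra.adjoin ℝ {e} with
      star_mem' := fun {a} ha => by
        have : star a = a := by ext; simp
        rwa [this] }
  have heA : e ∈ A := Algebra.self_mem_adjoin_singleton ℝ e
  refine ext_of_forall_mem_subalgebra_integral_eq_of_polish (𝕜 := ℝ) (A := A) ?_ ?_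
  · intro s t hst
    refine ⟨e, ⟨_, ⟨e, heA, rfl⟩, rfl⟩, ?_⟩
    simpa [e] using hst
  · intro g hg
    have hg' : g ∈ Algebra.adjoin ℝ {e} := hg
    rw [Algebra.adjoin_singleton_eq_range_aeval] at hg'
    obtain ⟨p, rfl⟩ := hg'
    induction p using Polynomial.induction_on' with
    | add p q hp hq =>
      have key : ∀ r : Polynomial ℝ, Polynomial.aeval e r ∈ A := fun r => by
        change _ ∈ Algebra.adjoin ℝ {e}
        rw [Algebra.adjoin_singleton_eq_range_aeval]
        exact ⟨r, rfl⟩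
      simp only [map_add, BoundedContinuousFunction.coe_add, Pi.add_apply]
      rw [integral_add (BoundedContinuousFunction.integrable _ _)
          (BoundedContinuousFunction.integrable _ _),
        integral_add (BoundedContinuousFunction.integrable _ _)
          (BoundedContinuousFunction.integrable _ _)]
      exact congrArg₂ _ (hp (key p)) (hq (key q))
    | monomial n a =>
      have hint : ∀ m : Measure ℝ≥0, ∫ t : ℝ≥0, Real.exp (-(n * t)) ∂m =
          (∫⁻ t, ENNReal.ofReal (Real.exp (-(n * t))) ∂m).toReal := fun m =>
        integral_eq_lintegral_of_nonneg_ae (.of_forall fun _ => (Real.exp_pos _).le)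
          (by fun_prop)
      have hpt : ∀ t : ℝ≥0, (Polynomial.aeval e (Polynomial.monomial n a)) t =
          a * Real.exp (-(n * t)) := fun t => by
        simp [Polynomial.aeval_monomial, e, ← Real.exp_nat_mul]
      change ∫ t, (Polynomial.aeval e (Polynomial.monomial n a)) t ∂m₁ =
        ∫ t, (Polynomial.aeval e (Polynomial.monomial n a)) t ∂m₂
      simp only [hpt, integral_const_mul, hint, h n]

/-- Two bounded right continuous functions on `[0, ∞)` with the same Laplace transform agree. -/
theorem eq_of_laplace_eq {g₁ g₂ : ℝ≥0 → ℝ≥0∞} (hm₁ : Measurable g₁) (hm₂ : Measurable g₂)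
    (hr₁ : IsRightContinuous g₁) (hr₂ : IsRightContinuous g₂) {C : ℝ≥0∞} (hC : C ≠ ∞)
    (hC₁ : ∀ t, g₁ t ≤ C) (hC₂ : ∀ t, g₂ t ≤ C)
    (h : ∀ α : ℝ, 0 < α →
      ∫⁻ t in Ioi (0 : ℝ), ENNReal.ofReal (Real.exp (-(α * t))) * g₁ t.toNNReal =
      ∫⁻ t in Ioi (0 : ℝ), ENNReal.ofReal (Real.exp (-(α * t))) * g₂ t.toNNReal) : g₁ = g₂ := by
  -- The weight `e^{-t}` makes the measures finite and shifts the index: their transform at `n` is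
  -- the hypothesis at `α = n + 1`, which is positive even for `n = 0`.
  let w : (ℝ≥0 → ℝ≥0∞) → ℝ → ℝ≥0∞ := fun g t => ENNReal.ofReal (Real.exp (-t)) * g t.toNNReal
  have hw : ∀ {g}, Measurable g → Measurable (w g) := fun hg =>
    Measurable.mul (by fun_prop) (hg.comp measurable_real_toNNReal)
  have hfin : ∀ {g}, (∀ t, g t ≤ C) → ∫⁻ t in Ioi (0 : ℝ), w g t ≠ ∞ := by
    intro g hg
    have h1 : ∫⁻ t in Ioi (0 : ℝ), ENNReal.ofReal (Real.exp (-t)) ≠ ∞ :=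
      (integrableOn_exp_neg_Ioi 0).lintegral_lt_top.ne
    refine ne_top_of_le_ne_top (ENNReal.mul_ne_top h1 hC) ?_
    rw [← lintegral_mul_const _ (by fun_prop)]
    exact lintegral_mono fun t => mul_le_mul_right (hg _) _
  let m : (ℝ≥0 → ℝ≥0∞) → Measure ℝ := fun g => (volume.restrict (Ioi 0)).withDensity (w g)
  have : IsFiniteMeasure (m g₁) := isFiniteMeasure_withDensity (hfin hC₁)
  have : IsFiniteMeasure (m g₂) := isFiniteMeasure_withDensity (hfin hC₂)
  have hexp : ∀ {g}, Measurable g → ∀ n : ℕ,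
      ∫⁻ t, ENNReal.ofReal (Real.exp (-(n * t))) ∂((m g).map Real.toNNReal) =
      ∫⁻ t in Ioi (0 : ℝ), ENNReal.ofReal (Real.exp (-((n + 1 : ℝ) * t))) * g t.toNNReal := by
    intro g hg n
    rw [lintegral_map (by fun_prop) measurable_real_toNNReal,
      lintegral_withDensity_eq_lintegral_mul _ (hw hg) (by fun_prop)]
    refine setLIntegral_congr_fun measurableSet_Ioi fun t ht => ?_
    have ht' : 0 ≤ t := le_of_lt ht
    simp only [w, Pi.mul_apply, Real.coe_toNNReal t ht']
    rw [mul_right_comm, ← ENNReal.ofReal_mul (Real.exp_pos _).le, ← Real.exp_add]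
    ring_nf
  have hmap : (m g₁).map Real.toNNReal = (m g₂).map Real.toNNReal :=
    measure_nnreal_ext_of_lintegral_exp fun n => by
      rw [hexp hm₁, hexp hm₂, h _ (by positivity)]
  -- Passing to `ℝ≥0` loses nothing, since these measures are carried by the positive half-line.
  have hback : ∀ g, ((m g).map Real.toNNReal).map ((↑) : ℝ≥0 → ℝ) = m g := by
    intro g
    rw [Measure.map_map (by fun_prop) (by fun_prop)]
    have hid : ((↑) : ℝ≥0 → ℝ) ∘ Real.toNNReal =ᵐ[m g] id := by
      refine (withDensity_absolutelyContinuous _ _).ae_le ?_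
      filter_upwards [ae_restrict_mem measurableSet_Ioi] with t ht
      exact Real.coe_toNNReal t (le_of_lt ht)
    rw [Measure.map_congr hid, Measure.map_id]
  have hm : m g₁ = m g₂ := by rw [← hback g₁, hmap, hback]
  have hae : ∀ᵐ t : ℝ ∂volume.restrict (Ioi 0), g₁ t.toNNReal = g₂ t.toNNReal := by
    have := (withDensity_eq_iff (hw hm₁).aemeasurable (hw hm₂).aemeasurable (hfin hC₁)).1 hm
    filter_upwards [this] with t ht
    exact (ENNReal.mul_right_inj (by simp [Real.exp_pos]) ENNReal.ofReal_ne_top).1 ht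
  funext t
  -- Intervals to the right of `t` have positive length, so almost everywhere equality yields points
  -- of agreement decreasing to `t`; right continuity concludes.
  have hfreq : ∃ᶠ s : ℝ in nhdsWithin (t : ℝ) (Ioi t), g₁ s.toNNReal = g₂ s.toNNReal := by
    intro hev
    obtain ⟨u, htu, hu⟩ := (mem_nhdsGT_iff_exists_Ioo_subset).1 hev
    rw [ae_restrict_iff' measurableSet_Ioi, ae_iff] at hae
    have h0 : volume (Ioo (t : ℝ) u) = 0 :=
      measure_mono_null (t := {s | ¬(s ∈ Ioi (0 : ℝ) → g₁ s.toNNReal = g₂ s.toNNReal)})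
        (fun s hs hs' => hu hs (hs' (t.2.trans_lt hs.1))) hae
    rw [Real.volume_Ioo, ENNReal.ofReal_eq_zero, sub_nonpos] at h0
    exact absurd htu (not_lt.2 h0)
  have hlim : Tendsto Real.toNNReal (nhdsWithin (t : ℝ) (Ioi t)) (nhdsWithin t (Ici t)) := by
    refine tendsto_nhdsWithin_iff.2 ⟨?_, ?_⟩
    · have := (continuous_real_toNNReal.tendsto (t : ℝ)).mono_left
        (nhdsWithin_le_nhds (s := Ioi (t : ℝ)))
      rwa [Real.toNNReal_coe] at this
    · filter_upwards [self_mem_nhdsWithin] with s hs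
      exact NNReal.le_toNNReal_of_coe_le (le_of_lt hs)
  exact tendsto_nhds_unique_of_frequently_eq ((hr₁ t).tendsto.comp hlim)
    ((hr₂ t).tendsto.comp hlim) hfreq

/-! ### Restriction of transition functions -/

/-- The resolvent fixes `P_t(x, ·)` only for almost every `t`; right continuity on bounded
continuous functions upgrades this to every `t`. Such functions determine the measure on Borel sets,
hence on universally measurable ones. -/
theorem IsRestrictedHD1.map_val_eq {E : Type u} [TopologicalSpace E]
    [TopologicalSpace.MetrizableSpace E] {P : ℝ≥0 → UKernel E} (hP : IsTransitionFunction P)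
    (h : HD1 P) {N : Set E} (hN : MeasurableSet[univMeas E] N)
    (hneg : IsWeaklyNegligible (mE := univMeas E) P N) {P' : ℝ≥0 → UKernel (Nᶜ : Set E)}
    (hP' : IsRestrictedHD1 P Nᶜ P') (t : ℝ≥0) (x : (Nᶜ : Set E)) :
    @Measure.map _ _ (univMeas (Nᶜ : Set E)) (univMeas E) Subtype.val (P' t x) = P t x := by
  let mE : MeasurableSpace E := univMeas E
  let mF : MeasurableSpace (Nᶜ : Set E) := univMeas (Nᶜ : Set E)
  have hval : Measurable (Subtype.val : (Nᶜ : Set E) → E) :=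
    continuous_subtype_val.measurable_univMeas
  have hmk := hP.markov
  have hmk' := hP'.transition.markov
  have key : ∀ (f : BoundedContinuousFunction E ℝ≥0),
      (fun t => ∫⁻ y, f (y : E) ∂(P' t x)) = fun t => ∫⁻ y, f y ∂(P t x) := by
    intro f
    let f' : BoundedContinuousFunction (Nᶜ : Set E) ℝ≥0 :=
      f.compContinuous ⟨_, continuous_subtype_val⟩
    have hfc : Continuous fun y => (f y : ℝ≥0∞) := ENNReal.continuous_coe.comp f.continuous
    have hfc' : Continuous fun y => (f' y : ℝ≥0∞) := ENNReal.continuous_coe.comp f'.continuous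
    refine eq_of_laplace_eq (hP'.hd1.measurable_lintegral hP'.transition x hfc'.borel_measurable)
      (h.measurable_lintegral hP x hfc.borel_measurable)
      (hP'.hd1.isRightContinuous_lintegral hP'.transition x f')
      (h.isRightContinuous_lintegral hP x f) (C := (nndist f 0 : ℝ≥0∞)) ENNReal.coe_ne_top
      (fun t => ?_) (fun t => ?_) fun α hα => ?_
    · have hle : ∀ y : (Nᶜ : Set E), (f y : ℝ≥0∞) ≤ nndist f 0 := fun y =>
        ENNReal.coe_le_coe.2 (BoundedContinuousFunction.NNReal.upper_bound f _)
      refine (lintegral_mono hle).trans ?_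
      simp
    · refine (lintegral_mono fun y => ENNReal.coe_le_coe.2
        (BoundedContinuousFunction.NNReal.upper_bound f y)).trans ?_
      simp
    · refine (hP'.resolvent_eq α hα (fun y => f y) hfc'.borel_measurable.univMeas_of_borel x).trans
        (lintegral_congr_ae ?_)
      -- For almost every `s` the zero extension of `f|_F` equals `f` almost everywhere for `P_s(x,
      -- ·)`.
      filter_upwards [hneg.ae_eq_zero hP h hN x.2] with s hs
      congr 1
      refine lintegral_congr_ae ?_
      have : ∀ᵐ y ∂(P s.toNNReal x), y ∉ N := measure_eq_zero_iff_ae_notMem.1 hs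
      filter_upwards [this] with y hy
      exact Subtype.val_injective.extend_apply (fun y : (Nᶜ : Set E) => (f y : ℝ≥0∞)) 0 ⟨y, hy⟩
  refine (measure_univMeas_ext ?_).symm
  have hle := borel_le_univMeas E
  refine @ext_of_forall_lintegral_eq_of_IsFiniteMeasure E (borel E) _ _
    (@BorelSpace.mk _ _ (borel E) rfl) _ _ (isFiniteMeasure_trim hle) fun f => ?_
  have hfc : @Measurable _ _ (borel E) _ fun y => (f y : ℝ≥0∞) :=
    (ENNReal.continuous_coe.comp f.continuous).borel_measurable
  rw [lintegral_trim hle hfc, lintegral_trim hle hfc, lintegral_map hfc.univMeas_of_borel hval]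
  exact (congrFun (key f) t).symm

/-! ### From a restricted transition function to quasi-absorption -/

/-- A realization of `P'` composed with the inclusion has the canonical law of `P`, and none of its
paths leaves `F`. -/
theorem isQuasiAbsorbing_of_map_val_eq {E : Type u} [TopologicalSpace E] {P : ℝ≥0 → UKernel E}
    (hP : IsTransitionFunction P) (h : HD1 P) {F : Set E} (hF : MeasurableSet[univMeas E] F)
    {P' : ℝ≥0 → UKernel F} (hP' : HD1 P')
    (hmap : ∀ t x, @Measure.map _ _ (univMeas F) (univMeas E) Subtype.val (P' t x) = P t x) :
    IsQuasiAbsorbing P hP h F := by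
  intro μ hμ hμF
  let mE : MeasurableSpace E := univMeas E
  let mF : MeasurableSpace F := univMeas F
  have hemb : MeasurableEmbedding (Subtype.val : F → E) := measurableEmbedding_val_univMeas hF
  have hμ' : (μ.comap Subtype.val).map (Subtype.val : F → E) = μ := by
    rw [hemb.map_comap, Subtype.range_coe]
    exact Measure.restrict_eq_self_of_ae_mem (measure_eq_zero_iff_ae_notMem.1 hμF |>.mono
      fun x hx => not_not.1 hx)
  have : IsProbabilityMeasure (μ.comap (Subtype.val : F → E)) := by
    constructor
    rw [← measure_univ (μ := μ), ← congrArg (fun m => m univ) hμ',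
      Measure.map_apply hemb.measurable MeasurableSet.univ, preimage_univ]
  obtain ⟨Ω, mΩ, 𝒢, Pr, X, hprob, hrc, hinit, hM⟩ := hP' (μ.comap Subtype.val) this
  have hX : ∀ t, Measurable (X t) := fun t => (hM.adapted t).mono (𝒢.le t) le_rfl
  have hM' : HasMarkovProperty 𝒢 Pr (fun t ω => (X t ω : E)) P := by
    refine ⟨fun t => hemb.measurable.comp (hM.adapted t), fun t s f hf ⟨C, hC⟩ => ?_⟩
    refine (hM.markov t s (fun y => f y) (hf.comp hemb.measurable) ⟨C, fun y => hC y⟩).trans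
      (.of_forall fun ω => ?_)
    simp only [← hmap, hemb.integral_map]
  let Φ : Ω → PathSpace E :=
    fun ω => ⟨fun t => X t ω, fun t => continuous_subtype_val.continuousAt.comp_continuousWithinAt
      (hrc ω t)⟩
  have hΦ : Measurable Φ := by
    refine Measurable.of_le_map (iSup_le fun t => ?_)
    rintro _ ⟨B, hB, rfl⟩
    exact hX t (hemb.measurable hB)
  have hΦt : ∀ t, Measurable[𝒢 t, pathFiltration E t] Φ := by
    intro t
    refine Measurable.of_le_map (iSup₂_le fun s hs => ?_)
    rintro _ ⟨B, hB, rfl⟩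
    exact 𝒢.mono hs _ (hM.adapted s (hemb.measurable hB))
  have hprob' : IsProbabilityMeasure (Pr.map Φ) :=
    Measure.isProbabilityMeasure_map hΦ.aemeasurable
  have := isProbabilityMeasure_canonicalLawFrom hP h μ
  have hlaw : Pr.map Φ = canonicalLawFrom P hP h μ := by
    refine HasMarkovProperty.law_unique hP.markov
      (hM'.map hP.markov hΦ hΦt (fun t => measurable_coord_filtration le_rfl) fun _ _ => rfl)
      (hasMarkovProperty_canonicalLawFrom hP h μ) ?_
    rw [map_coord_zero_canonicalLawFrom hP h μ, Measure.map_map (measurable_coord 0) hΦ, ← hμ',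
      ← hinit, Measure.map_map hemb.measurable (hX 0)]
    rfl
  rw [← hlaw]
  refine le_antisymm prob_le_one ?_
  -- This inequality holds for arbitrary sets, so the set of paths in `F` need not be measurable.
  refine le_trans ?_ (Measure.le_map_apply hΦ.aemeasurable _)
  have huniv : Φ ⁻¹' {ω | ∀ t, coord t ω ∈ F} = univ := eq_univ_of_forall fun ω t => (X t ω).2
  rw [huniv, measure_univ]

/-! ### From quasi-absorption to a restricted transition function -/

/-- The restriction of the kernel `K` to `F`. -/
noncomputable def restrictUKernel {E : Type u} [TopologicalSpace E] (K : UKernel E) {F : Set E}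
    (hF : MeasurableSet[univMeas E] F) : UKernel F :=
  letI := univMeas E
  letI := univMeas F
  (K.comap Subtype.val (measurableEmbedding_val_univMeas hF).measurable).comapRight
    (measurableEmbedding_val_univMeas hF)

theorem map_val_restrictUKernel {E : Type u} [TopologicalSpace E] {K : UKernel E} {F : Set E}
    (hF : MeasurableSet[univMeas E] F) {x : F} (hx : K x Fᶜ = 0) :
    @Measure.map _ _ (univMeas F) (univMeas E) Subtype.val (restrictUKernel K hF x) = K x := by
  let mE : MeasurableSpace E := univMeas E
  let mF : MeasurableSpace F := univMeas F
  have hemb : MeasurableEmbedding (Subtype.val : F → E) := measurableEmbedding_val_univMeas hF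
  rw [restrictUKernel, Kernel.comapRight_apply, hemb.map_comap, Subtype.range_coe,
    Kernel.comap_apply]
  exact Measure.restrict_eq_self_of_ae_mem (measure_eq_zero_iff_ae_notMem.1 hx |>.mono
    fun x hx => not_not.1 hx)

/-- Starting from the point mass at `x`, the set of paths in `F` has outer measure 1 and lies in the
measurable event `X_t ∈ F`, whose probability is `P_t(x, F)`. -/
theorem IsQuasiAbsorbing.apply_compl_eq_zero {E : Type u} [TopologicalSpace E]
    {P : ℝ≥0 → UKernel E} {hP : IsTransitionFunction P} {h : HD1 P} {F : Set E}
    (hF : MeasurableSet[univMeas E] F) (hq : IsQuasiAbsorbing P hP h F) (t : ℝ≥0) {x : E}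
    (hx : x ∈ F) : P t x Fᶜ = 0 := by
  let mE : MeasurableSpace E := univMeas E
  have hδ := hq (Measure.dirac x) inferInstance (by
    rw [Measure.dirac_apply' _ hF.compl]
    simp [hx])
  have hc := isCanonicalLaw_canonicalLaw hP h
  have := hc.isProb
  rw [canonicalLawFrom, Measure.dirac_bind (canonicalLaw P hP h).measurable] at hδ
  have hmk := hP.markov
  have hf : Measurable (F.indicator fun _ => (1 : ℝ)) := measurable_const.indicator hF
  have hC : ∀ y, |F.indicator (fun _ => (1 : ℝ)) y| ≤ 1 := fun y => by
    by_cases hy : y ∈ F <;> simp [hy]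
  obtain ⟨hKm, -⟩ := integral_kernel_bdd (K := P t) hf hC
  have e := (hc.markov x).setIntegral_eq (t := 0) (s := t) hf hC MeasurableSet.univ
  simp only [zero_add, Measure.restrict_univ] at e
  rw [← integral_map (f := F.indicator fun _ => (1 : ℝ)) (measurable_coord t).aemeasurable
      hf.aestronglyMeasurable,
    ← integral_map (f := fun z => ∫ y, F.indicator (fun _ => (1 : ℝ)) y ∂(P t z))
      (measurable_coord 0).aemeasurable hKm.aestronglyMeasurable, hc.start,
    integral_dirac' _ _ hKm.stronglyMeasurable, integral_indicator_const _ hF,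
    integral_indicator_const _ hF] at e
  have h1 : canonicalLaw P hP h x (coord t ⁻¹' F) = 1 :=
    le_antisymm prob_le_one (hδ ▸ measure_mono fun ω hω => hω t)
  rw [prob_compl_eq_zero_iff hF]
  simp only [Measure.real, Measure.map_apply (measurable_coord t) hF, h1] at e
  exact (ENNReal.toReal_eq_one_iff _).1 (by simpa using e.symm)

/-- No mass of `P_t(x, ·)` lies outside `F`, so the algebraic identities and the resolvent restrict.
`HD1` comes from the trace of the canonical law on the paths in `F`, whose image under inclusion is
the canonical law itself. -/
theorem IsQuasiAbsorbing.isRestrictedHD1 {E : Type u} [TopologicalSpace E]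
    {P : ℝ≥0 → UKernel E} {hP : IsTransitionFunction P} {h : HD1 P} {F : Set E}
    (hF : MeasurableSet[univMeas E] F) (hq : IsQuasiAbsorbing P hP h F) :
    IsRestrictedHD1 P F fun t => restrictUKernel (P t) hF := by
  let mE : MeasurableSpace E := univMeas E
  let mF : MeasurableSpace F := univMeas F
  have hemb : MeasurableEmbedding (Subtype.val : F → E) := measurableEmbedding_val_univMeas hF
  have hmap : ∀ t (x : F), (restrictUKernel (P t) hF x).map Subtype.val = P t x := fun t x =>
    map_val_restrictUKernel hF (hq.apply_compl_eq_zero hF t x.2)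
  have happly : ∀ t (x : F) (B : Set F), restrictUKernel (P t) hF x B =
      P t x (Subtype.val '' B) := fun t x B => by
    rw [← hmap, hemb.map_apply, preimage_image_eq _ Subtype.val_injective]
  have hmk : ∀ t, IsMarkovKernel (restrictUKernel (P t) hF) := fun t => ⟨fun x => ⟨by
    have := (hP.markov t).isProbabilityMeasure (x : E)
    rw [← measure_univ (μ := P t x), ← hmap, hemb.map_apply, preimage_univ]⟩⟩
  refine ⟨⟨hmk, fun t s x B hB => ?_⟩, fun μ hμ => ?_, fun α hα f hf x => ?_⟩
  · rw [happly, hP.chapman_kolmogorov t s x _ (hemb.measurableSet_image.2 hB), ← hmap,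
      hemb.lintegral_map]
    simp only [happly]
  · have hμ' : IsProbabilityMeasure (μ.map (Subtype.val : F → E)) :=
      Measure.isProbabilityMeasure_map hemb.measurable.aemeasurable
    let S : Set (PathSpace E) := {ω | ∀ t, coord t ω ∈ F}
    let Q := canonicalLawFrom P hP h (μ.map Subtype.val)
    have hQ : IsProbabilityMeasure Q := isProbabilityMeasure_canonicalLawFrom hP h _
    have hQM : HasMarkovProperty (pathFiltration E) Q coord P :=
      hasMarkovProperty_canonicalLawFrom hP h _
    have hQS : Q S = Q univ := by
      rw [measure_univ]
      refine hq _ hμ' ?_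
      rw [Measure.map_apply hemb.measurable hF.compl]
      simp
    let mS : MeasurableSpace S := (pathMeasurableSpace E).comap Subtype.val
    have hval : Measurable (Subtype.val : S → PathSpace E) := comap_measurable _
    let 𝒢 : Filtration ℝ≥0 mS :=
      { seq := fun t => (pathFiltration E t).comap Subtype.val
        mono' := fun _ _ hst => MeasurableSpace.comap_mono ((pathFiltration E).mono hst)
        le' := fun t => MeasurableSpace.comap_mono ((pathFiltration E).le t) }
    let Pr : Measure S := traceMeasure Q S
    have hPr : Pr.map Subtype.val = Q := map_traceMeasure hQS
    have hprob : IsProbabilityMeasure Pr := by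
      constructor
      rw [← measure_univ (μ := Q), ← hPr, Measure.map_apply hval MeasurableSet.univ, preimage_univ]
    let X : ℝ≥0 → S → F := fun t ω => ⟨coord t ω.1, ω.2 t⟩
    have hXt : ∀ t, Measurable[𝒢 t] (X t) := fun t B hB =>
      ⟨coord t ⁻¹' (Subtype.val '' B),
        measurable_coord_filtration le_rfl (hemb.measurableSet_image.2 hB), by
          ext ω
          change ((X t ω : F) : E) ∈ Subtype.val '' B ↔ X t ω ∈ B
          exact Subtype.val_injective.mem_set_image⟩
    have hX0 : Measurable (X 0) := (hXt 0).mono (𝒢.le 0) le_rfl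
    refine ⟨S, mS, 𝒢, Pr, X, hprob, fun ω t => ?_, ?_, ?_⟩
    · exact Topology.IsInducing.subtypeVal.continuousWithinAt_iff.2 (ω.1.2 t)
    -- Initial laws are compared in `E`; the inclusion is injective with measurable images, so
    -- nothing is lost.
    · have h1 : (Pr.map (X 0)).map (Subtype.val : F → E) = μ.map Subtype.val := by
        rw [Measure.map_map hemb.measurable hX0,
          ← map_coord_zero_canonicalLawFrom hP h (μ.map Subtype.val)]
        change _ = Measure.map (coord 0) Q
        rw [← hPr, Measure.map_map (measurable_coord 0) hval]
        rfl
      ext B hB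
      have h2 := congrArg (fun m => m (Subtype.val '' B)) h1
      simpa only [hemb.map_apply, preimage_image_eq _ Subtype.val_injective] using h2
    -- Events of the trace filtration are traces of events in path space. Extending `f` by zero
    -- turns the claim into the Markov property of the canonical law.
    · refine .of_setIntegral_eq hmk hXt fun t s f hf C hC A hA => ?_
      obtain ⟨A, hA, rfl⟩ := hA
      have hA' := (pathFiltration E).le t _ hA
      have hfe : Measurable (Function.extend Subtype.val f (0 : E → ℝ)) :=
        hemb.measurable_extend hf measurable_const
      have hfe_apply : ∀ y : F, Function.extend Subtype.val f (0 : E → ℝ) y = f y := fun y =>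
        Subtype.val_injective.extend_apply _ _ _
      have hCe : ∀ y, |Function.extend Subtype.val f (0 : E → ℝ) y| ≤ C := fun y => by
        by_cases hy : y ∈ F
        · rw [hfe_apply ⟨y, hy⟩]
          exact hC _
        · rw [Function.extend_apply' _ _ _ (by rintro ⟨z, rfl⟩; exact hy z.2)]
          -- The default value 0 respects the bound only if `0 ≤ C`, which requires a point of `F`;
          -- `μ` being a probability supplies one.
          obtain ⟨x₀⟩ : Nonempty F := nonempty_of_isProbabilityMeasure μ
          simpa using (abs_nonneg _).trans (hC x₀)
      have := hP.markov s
      obtain ⟨hKm, -⟩ := integral_kernel_bdd (K := P s) hfe hCe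
      have e := hQM.setIntegral_eq (s := s) hfe hCe hA
      have h1 : Measurable fun ω : PathSpace E =>
          Function.extend Subtype.val f (0 : E → ℝ) (coord (t + s) ω) :=
        hfe.comp (measurable_coord _)
      have h2 : Measurable fun ω : PathSpace E =>
          ∫ y, Function.extend Subtype.val f (0 : E → ℝ) y ∂(P s (coord t ω)) :=
        hKm.comp (measurable_coord _)
      rw [← hPr, setIntegral_map hA' h1.aestronglyMeasurable hval.aemeasurable,
        setIntegral_map hA' h2.aestronglyMeasurable hval.aemeasurable] at e
      refine Eq.trans ?_ (e.trans ?_)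
      · exact integral_congr_ae (.of_forall fun ω => (hfe_apply (X (t + s) ω)).symm)
      · refine integral_congr_ae (.of_forall fun ω => ?_)
        change ∫ y, Function.extend Subtype.val f (0 : E → ℝ) y ∂(P s (X t ω : F)) = _
        rw [← hmap, hemb.integral_map]
        simp only [hfe_apply]
  · simp only [markovResolvent, restrictedResolvent, ← hmap, hemb.lintegral_map,
      Subtype.val_injective.extend_apply]

theorem theorem2p4 {E : Type u} [TopologicalSpace E] (hE : IsRadonSpace E)
    (P : ℝ≥0 → UKernel E) (hP : IsTransitionFunction P) (hnormal : IsNormalTransition P)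
    (hHD1 : HD1 P) (N : Set E) (hN : MeasurableSet[univMeas E] N)
    (hneg : IsWeaklyNegligible P N) :
    ((∃ P' : ℝ≥0 → UKernel (Nᶜ : Set E), IsRestrictedHD1 P Nᶜ P') ↔
      IsQuasiAbsorbing P hP hHD1 Nᶜ) ∧
    ∀ P' : ℝ≥0 → UKernel (Nᶜ : Set E), IsRestrictedHD1 P Nᶜ P' →
      ∀ (t : ℝ≥0) (x : (Nᶜ : Set E)) (B : Set (Nᶜ : Set E)),
        MeasurableSet[univMeas (Nᶜ : Set E)] B → P' t x B = P t x (Subtype.val '' B) := by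
  -- The embedding into a metric space provides metrizability, on which the joint measurability and
  -- the determination of measures by bounded continuous functions rest.
  obtain ⟨K, _, _, e, he, -⟩ := hE
  have : TopologicalSpace.MetrizableSpace E := he.metrizableSpace
  have hF : MeasurableSet[univMeas E] Nᶜ := hN.compl
  refine ⟨⟨fun ⟨P', hP'⟩ => ?_, fun hq => ⟨_, hq.isRestrictedHD1 hF⟩⟩, fun P' hP' t x B _ => ?_⟩
  · exact isQuasiAbsorbing_of_map_val_eq hP hHD1 hF hP'.hd1 (hP'.map_val_eq hP hHD1 hN hneg)
  · rw [← hP'.map_val_eq hP hHD1 hN hneg t x,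
      @MeasurableEmbedding.map_apply _ _ (univMeas _) (univMeas _) _
        (measurableEmbedding_val_univMeas hF), preimage_image_eq _ Subtype.val_injective]
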